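/- Let $n\ge 1$ and let $f:[0,1]^n\to[0,\infty)$ be continuous. Write $a_+=\max(a,0)$. For $y\in[0,1]^n$ consider the problem $$(\mathrm{P1}_y)\qquad (u_{x_1})_+\cdots(u_{x_n})_+=f\ \text{ in }\prod_{i=1}^n(y_i,1],\qquad u=0\ \text{ on }\prod_{i=1}^n[y_i,1]\setminus\prod_{i=1}^n(y_i,1],$$ let (P1) be $(\mathrm{P1}_0)$, and consider $$(\mathrm{P2})\qquad (v_{x_1})_+\cdots(v_{x_n})_+=v^{n-1}f\ \text{ in }(0,1]^n,\qquad v=0\ \text{ on }\Gamma:=[0,1]^n\setminus(0,1]^n .$$ A viscosity subsolution (supersolution) of such a problem, with right-hand side $G(x,v)$ in $D=\prod_i(y_i,1]$, is an upper (lower) semicontinuous function $v$ on $\overline D=\prod_i[y_i,1]$ with $v\le 0$ ($v\ge 0$) on $\overline D\setminus D$ such that for every $x_0\in D$ and every $\varphi\in C^1$ for which $v-\varphi$ has a local maximum (minimum) at $x_0$ relative to $D$, one has $\prod_i(\varphi_{x_i}(x_0))_+\le G(x_0,v(x_0))$ (respectively $\ge$). A viscosity solution is a function that is both. Nondecreasing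 means nondecreasing in each variable. 1. For every $y\in[0,1]^n$ problem $(\mathrm{P1}_y)$ has exactly one nondecreasing viscosity solution on $\prod_i[y_i,1]$. 2. Let $u$ be the nondecreasing viscosity solution of (P1). Then every nonnegative upper semicontinuous viscosity subsolution $v$ of (P2) satisfies $v\le u^n/n^n$ on $[0,1]^n$. Moreover $u^n/n^n$ is itself a nondecreasing viscosity solution of (P2); thus it is the maximal nonnegative viscosity solution of (P2). 3. Suppose $n\ge 2$, let $y\in[0,1]^n$, and let $u$ be the nondecreasing viscosity solution of $(\mathrm{P1}_y)$, extended by $0$ to $[0,1]^n\setminus\prod_i[y_i,1]$. Then $u^n/n^n$ is a nondecreasing viscosity solution of (P2). 4. If $n\ge 2$ and $f\not\equiv 0$ on $[0,1]^n$, then (P2) has infinitely many nondecreasing viscosity solutions on $[0,1]^n$. -/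

import Mathlib

open Set

namespace NondomHJ

/-- The half-open box `∏ i, (y i, 1]`. -/
def halfOpenBox {n : ℕ} (y : Fin n → ℝ) : Set (Fin n → ℝ) :=
  {x | ∀ i, y i < x i ∧ x i ≤ 1}

/-- The part `∏ i, [y i, 1] \ ∏ i, (y i, 1]` of the boundary on which the Dirichlet condition
is imposed. For `y = 0` this is `∂[0,1]ⁿ \ (0,1]ⁿ`. -/
def lowerBoundary {n : ℕ} (y : Fin n → ℝ) : Set (Fin n → ℝ) :=
  Icc y 1 \ halfOpenBox y

/-- The product `(∂₁φ(x))₊ ⋯ (∂ₙφ(x))₊` of the positive parts of the partial derivatives. -/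
noncomputable def posPartProd {n : ℕ} (φ : (Fin n → ℝ) → ℝ) (x : Fin n → ℝ) : ℝ :=
  ∏ i, max (fderiv ℝ φ x (Pi.single i 1)) 0

/-- `v` is a viscosity subsolution of the Dirichlet problem
`(v_{x₁})₊ ⋯ (v_{xₙ})₊ = G(x, v)` in `∏ (y i, 1]`, `v = 0` on the lower boundary.
Only the values of `v` on `∏ [y i, 1]` matter. Local maxima are relative to `∏ (y i, 1]`,
so the equation is also imposed at the points of this set with some coordinate equal to `1`. -/
structure IsViscositySubsolution {n : ℕ} (y : Fin n → ℝ) (G : (Fin n → ℝ) → ℝ → ℝ)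
    (v : (Fin n → ℝ) → ℝ) : Prop where
  usc : UpperSemicontinuousOn v (Icc y 1)
  boundary : ∀ x ∈ lowerBoundary y, v x ≤ 0
  equation : ∀ x ∈ halfOpenBox y, ∀ φ : (Fin n → ℝ) → ℝ, ContDiff ℝ 1 φ →
    IsLocalMaxOn (fun z => v z - φ z) (halfOpenBox y) x → posPartProd φ x ≤ G x (v x)

/-- `v` is a viscosity supersolution of the same Dirichlet problem. -/
structure IsViscositySupersolution {n : ℕ} (y : Fin n → ℝ) (G : (Fin n → ℝ) → ℝ → ℝ)
    (v : (Fin n → ℝ) → ℝ) : Prop where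
  lsc : LowerSemicontinuousOn v (Icc y 1)
  boundary : ∀ x ∈ lowerBoundary y, 0 ≤ v x
  equation : ∀ x ∈ halfOpenBox y, ∀ φ : (Fin n → ℝ) → ℝ, ContDiff ℝ 1 φ →
    IsLocalMinOn (fun z => v z - φ z) (halfOpenBox y) x → G x (v x) ≤ posPartProd φ x

/-- `v` is a nondecreasing viscosity solution of the Dirichlet problem: it is nondecreasing on
`∏ [y i, 1]` and both a subsolution and a supersolution (hence continuous on `∏ [y i, 1]`, and
zero on the lower boundary). -/
structure IsNondecreasingSolution {n : ℕ} (y : Fin n → ℝ) (G : (Fin n → ℝ) → ℝ → ℝ)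
    (v : (Fin n → ℝ) → ℝ) : Prop where
  mono : MonotoneOn v (Icc y 1)
  sub : IsViscositySubsolution y G v
  super : IsViscositySupersolution y G v

/-- Right-hand side of `(u_{x₁})₊ ⋯ (u_{xₙ})₊ = f`. -/
def rhs₁ {n : ℕ} (f : (Fin n → ℝ) → ℝ) : (Fin n → ℝ) → ℝ → ℝ :=
  fun x _ => f x

/-- Right-hand side of `(v_{x₁})₊ ⋯ (v_{xₙ})₊ = v ^ (n - 1) f`. -/
def rhs₂ {n : ℕ} (f : (Fin n → ℝ) → ℝ) : (Fin n → ℝ) → ℝ → ℝ :=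
  fun x z => z ^ (n - 1) * f x

open Classical in
/-- Extension by zero of a function on `∏ [y i, 1]`. -/
noncomputable def extendByZero {n : ℕ} (y : Fin n → ℝ) (u : (Fin n → ℝ) → ℝ) :
    (Fin n → ℝ) → ℝ :=
  fun x => if x ∈ Icc y 1 then u x else 0

end NondomHJ

/-! Existence comes from optimal control. By AM-GM, `n (∏ pᵢ)^{1/n} (∏ dᵢ)^{1/n} ≤ ∑ pᵢ dᵢ` for
nonnegative `p`, `d`, with equality when all `pᵢ dᵢ` agree. Hence `∏ (u_{xᵢ})₊ = f` is the dynamic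
programming equation for maximizing `∫ n (f(γ) γ₁' ⋯ γₙ')^{1/n}` over nondecreasing paths from `y`
to `x`. Lower Riemann sums along polygonal paths (`Reach`) replace the integral, and `valueFn` is
their supremum. Appending a segment (`valueFn_add_le`) gives the supersolution property; cutting a
near-optimal path on a prescribed level set (`valueFn_crossing`) gives the subsolution property and
continuity.

Uniqueness is a comparison by doubling of variables. Only the supersolution has to be nondecreasing:
its test gradient is then nonnegative, and raising each component by `ε` raises the product by at
least `ε ^ n`.

Formally `u = n v^{1/n}` has `u_{xᵢ} = v^{1/n-1} v_{xᵢ}`, which turns (P2) into (P1) where `v > 0`.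
Where a nonnegative `v` vanishes, functions touching from above have a local minimum, so the
subsolution inequality is trivial. Comparison after this substitution yields maximality, since the
subsolution of (P2) need not be monotone. For `n ≥ 2` the right-hand side `v^{n-1} f` also vanishes
where `v = 0`, so the supersolution inequality is free there and zero extensions from smaller boxes
solve (P2). Different lower corners at which `f > 0` give different solutions. -/

open Filter Topology

namespace NondomHJ

/-! ### Geometric means and Riemann sums along monotone paths -/

section

variable {n : ℕ}

/-- The geometric mean of the coordinates. -/
noncomputable def geomMean (d : Fin n → ℝ) : ℝ := (∏ i, d i) ^ ((n : ℝ)⁻¹)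

lemma geomMean_nonneg {d : Fin n → ℝ} (hd : ∀ i, 0 ≤ d i) : 0 ≤ geomMean d :=
  Real.rpow_nonneg (Finset.prod_nonneg fun i _ => hd i) _

lemma geomMean_pow (hn : n ≠ 0) {d : Fin n → ℝ} (hd : ∀ i, 0 ≤ d i) :
    geomMean d ^ n = ∏ i, d i :=
  Real.rpow_inv_natCast_pow (Finset.prod_nonneg fun i _ => hd i) hn

lemma geomMean_smul (hn : n ≠ 0) {t : ℝ} (ht : 0 ≤ t) {d : Fin n → ℝ} (hd : ∀ i, 0 ≤ d i) :
    geomMean (t • d) = t * geomMean d := by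
  unfold geomMean
  simp only [Pi.smul_apply, smul_eq_mul, Finset.prod_mul_distrib, Finset.prod_const,
    Finset.card_univ, Fintype.card_fin]
  rw [Real.mul_rpow (pow_nonneg ht _) (Finset.prod_nonneg fun i _ => hd i),
    Real.pow_rpow_inv_natCast ht hn]

lemma geomMean_mul {p d : Fin n → ℝ} (hp : ∀ i, 0 ≤ p i) (hd : ∀ i, 0 ≤ d i) :
    geomMean (fun i => p i * d i) = geomMean p * geomMean d := by
  unfold geomMean
  rw [Finset.prod_mul_distrib, Real.mul_rpow (Finset.prod_nonneg fun i _ => hp i)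
    (Finset.prod_nonneg fun i _ => hd i)]

lemma geomMean_eq_zero (hn : n ≠ 0) {a : Fin n → ℝ} {i : Fin n} (hi : a i = 0) :
    geomMean a = 0 := by
  unfold geomMean
  rw [Finset.prod_eq_zero (Finset.mem_univ i) hi, Real.zero_rpow]
  simpa using hn

lemma natCast_mul_geomMean_le_sum (hn : n ≠ 0) {d : Fin n → ℝ} (hd : ∀ i, 0 ≤ d i) :
    n * geomMean d ≤ ∑ i, d i := by
  have hn' : (0 : ℝ) < n := by positivity
  have h := Real.geom_mean_le_arith_mean Finset.univ (fun _ : Fin n => (1 : ℝ)) d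
    (fun _ _ => zero_le_one) (by simpa using hn') fun i _ => hd i
  simp only [Real.rpow_one, one_mul, Finset.sum_const, Finset.card_univ, Fintype.card_fin,
    nsmul_eq_mul, mul_one] at h
  rwa [le_div_iff₀ hn', mul_comm] at h

/-- AM-GM applied to the ratios `aᵢ / (aᵢ + bᵢ)` and `bᵢ / (aᵢ + bᵢ)`, whose sums add up to `n`. A
coordinate with `aᵢ + bᵢ = 0` makes all three means vanish. This superadditivity says that, at a
constant rate, a straight segment beats any monotone detour. -/
lemma geomMean_add_le (hn : n ≠ 0) {a b : Fin n → ℝ} (ha : ∀ i, 0 ≤ a i) (hb : ∀ i, 0 ≤ b i) :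
    geomMean a + geomMean b ≤ geomMean (a + b) := by
  have hn' : (0 : ℝ) < n := by positivity
  by_cases h : ∃ i, a i + b i = 0
  · obtain ⟨i, hi⟩ := h
    have h1 : a i = 0 := by linarith [ha i, hb i]
    have h2 : b i = 0 := by linarith [ha i, hb i]
    rw [geomMean_eq_zero hn h1, geomMean_eq_zero hn h2, geomMean_eq_zero hn (i := i)]
    · simp
    · simpa using hi
  · push Not at h
    have hpos : ∀ i, 0 < a i + b i := fun i => lt_of_le_of_ne (add_nonneg (ha i) (hb i)) (h i).symm
    have key : ∀ c : Fin n → ℝ, (∀ i, 0 ≤ c i) →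
        n * geomMean c ≤ geomMean (a + b) * ∑ i, c i / (a i + b i) := by
      intro c hc
      have hc' : ∀ i, 0 ≤ c i / (a i + b i) := fun i => div_nonneg (hc i) (hpos i).le
      have h1 : geomMean c = geomMean (a + b) * geomMean (fun i => c i / (a i + b i)) := by
        rw [← geomMean_mul (p := a + b) (fun i => (hpos i).le) hc']
        congr 1; ext i
        simp only [Pi.add_apply]
        field_simp [(hpos i).ne']
      rw [h1]
      have := mul_le_mul_of_nonneg_left (natCast_mul_geomMean_le_sum hn hc')
        (geomMean_nonneg (d := a + b) fun i => (hpos i).le)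
      linarith
    have hs : ∑ i, a i / (a i + b i) + ∑ i, b i / (a i + b i) = n := by
      rw [← Finset.sum_add_distrib]
      have : ∀ i ∈ Finset.univ, a i / (a i + b i) + b i / (a i + b i) = 1 := fun i _ => by
        rw [← add_div, div_self (hpos i).ne']
      rw [Finset.sum_congr rfl this]; simp
    have h1 := key a ha
    have h2 := key b hb
    have h3 : (n : ℝ) * (geomMean a + geomMean b) ≤ n * geomMean (a + b) := by
      calc _ ≤ geomMean (a + b) * (∑ i, a i / (a i + b i) + ∑ i, b i / (a i + b i)) := by linarith
        _ = _ := by rw [hs, mul_comm]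
    exact le_of_mul_le_mul_left h3 hn'

/-- `Reach f y x s` says that `s` is a lower Riemann sum of
`∫ n (f(γ) γ₁' ⋯ γₙ')^{1/n}` along a nondecreasing polygonal path `γ` from `y` to `x`. -/
inductive Reach (f : (Fin n → ℝ) → ℝ) (y : Fin n → ℝ) : (Fin n → ℝ) → ℝ → Prop
  | base : Reach f y y 0
  | step {z x : Fin n → ℝ} {s κ : ℝ} (h : Reach f y z s) (hzx : z ≤ x) (hκ : 0 ≤ κ)
      (hf : ∀ w ∈ Icc z x, κ ^ n ≤ f w) : Reach f y x (s + n * κ * geomMean (x - z))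

variable {f : (Fin n → ℝ) → ℝ} {y x : Fin n → ℝ} {s : ℝ}

lemma Reach.le (h : Reach f y x s) : y ≤ x := by
  induction h with
  | base => exact le_rfl
  | step _ hzx _ _ ih => exact ih.trans hzx

lemma le_of_pow_le_pow_nat (hn : n ≠ 0) {a b : ℝ} (hb : 0 ≤ b) (h : a ^ n ≤ b ^ n) : a ≤ b :=
  le_of_pow_le_pow_left₀ hn hb h

/-- The total sum is at most the upper bound along a single segment. -/
lemma Reach.le_mul_geomMean (hn : n ≠ 0) (h : Reach f y x s) {K : ℝ} (hK : 0 ≤ K)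
    (hfK : ∀ w ∈ Icc y x, f w ≤ K ^ n) : s ≤ n * K * geomMean (x - y) := by
  induction h with
  | base =>
    have := geomMean_nonneg (d := y - y) (by simp)
    positivity
  | @step z x s κ h hzx hκ hf ih =>
    have h1 := ih fun w hw => hfK w ⟨hw.1, hw.2.trans hzx⟩
    have hκK : κ ≤ K := le_of_pow_le_pow_nat hn hK
      ((hf x ⟨hzx, le_rfl⟩).trans (hfK x ⟨h.le.trans hzx, le_rfl⟩))
    have h2 := geomMean_add_le hn (a := z - y) (b := x - z) (fun i => sub_nonneg.2 (h.le i))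
      (fun i => sub_nonneg.2 (hzx i))
    rw [sub_add_sub_comm, add_comm z x, ← sub_add_sub_comm, sub_self, add_zero] at h2
    have h3 := geomMean_nonneg (d := x - z) (fun i => sub_nonneg.2 (hzx i))
    calc s + n * κ * geomMean (x - z) ≤ n * K * geomMean (z - y) + n * K * geomMean (x - z) := by
          gcongr
      _ = n * K * (geomMean (z - y) + geomMean (x - z)) := by ring
      _ ≤ _ := by gcongr

/-- Any path from `y` to `x` can be cut where a continuous function `g` vanishes. -/
lemma Reach.exists_crossing (hn : n ≠ 0) (h : Reach f y x s) {g : (Fin n → ℝ) → ℝ}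
    (hg : Continuous g) (hy : g y ≤ 0) (hx : 0 ≤ g x) :
    ∃ z t, Reach f y z t ∧ g z = 0 ∧ z ≤ x ∧ ∀ K : ℝ, 0 ≤ K → (∀ w ∈ Icc z x, f w ≤ K ^ n) →
      s ≤ t + n * K * geomMean (x - z) := by
  induction h with
  | base =>
    refine ⟨y, 0, .base, le_antisymm hy hx, le_rfl, fun K hK _ => ?_⟩
    have := geomMean_nonneg (d := y - y) (by simp)
    positivity
  | @step z x s κ h hzx hκ hf ih =>
    by_cases hz : 0 ≤ g z
    · obtain ⟨w, t, hw, hgw, hwz, H⟩ := ih hz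
      refine ⟨w, t, hw, hgw, hwz.trans hzx, fun K hK hfK => ?_⟩
      have h1 := H K hK fun w' hw' => hfK w' ⟨hw'.1, hw'.2.trans hzx⟩
      have hκK : κ ≤ K := le_of_pow_le_pow_nat hn hK
        ((hf x ⟨hzx, le_rfl⟩).trans (hfK x ⟨hwz.trans hzx, le_rfl⟩))
      have h2 := geomMean_add_le hn (a := z - w) (b := x - z) (fun i => sub_nonneg.2 (hwz i))
        (fun i => sub_nonneg.2 (hzx i))
      rw [sub_add_sub_comm, add_comm z x, ← sub_add_sub_comm, sub_self, add_zero] at h2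
      have h3 := geomMean_nonneg (d := x - z) (fun i => sub_nonneg.2 (hzx i))
      calc s + n * κ * geomMean (x - z)
          ≤ (t + n * K * geomMean (z - w)) + n * K * geomMean (x - z) := by gcongr
        _ = t + n * K * (geomMean (z - w) + geomMean (x - z)) := by ring
        _ ≤ _ := by gcongr
    -- Here `g` changes sign inside the last segment. Homogeneity of `geomMean` splits the
    -- contribution of that segment exactly at the crossing point.
    · push Not at hz
      have hd : ∀ i, 0 ≤ (x - z) i := fun i => sub_nonneg.2 (hzx i)
      have hcont : ContinuousOn (fun τ : ℝ => g (z + τ • (x - z))) (Icc 0 1) := by fun_prop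
      obtain ⟨τ, ⟨hτ0, hτ1⟩, hτ⟩ := intermediate_value_Icc zero_le_one hcont
        (show (0 : ℝ) ∈ Icc _ _ by simpa using ⟨hz.le, hx⟩)
      have e2 : x - (z + τ • (x - z)) = (1 - τ) • (x - z) := by
        rw [sub_smul, one_smul]; abel
      have hzw : z ≤ z + τ • (x - z) := fun i => by
        have := mul_nonneg hτ0 (hd i)
        simpa using this
      have hwx : z + τ • (x - z) ≤ x := by
        rw [← sub_nonneg, e2]
        exact fun i => mul_nonneg (sub_nonneg.2 hτ1) (hd i)
      refine ⟨z + τ • (x - z), _, h.step hzw hκ fun w hw => hf w ⟨hw.1, hw.2.trans hwx⟩, hτ, hwx,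
        fun K hK hfK => ?_⟩
      have hκK : κ ≤ K := le_of_pow_le_pow_nat hn hK
        ((hf x ⟨hzx, le_rfl⟩).trans (hfK x ⟨hwx, le_rfl⟩))
      rw [e2, add_sub_cancel_left, geomMean_smul hn hτ0 hd,
        geomMean_smul hn (sub_nonneg.2 hτ1) hd]
      have h3 := geomMean_nonneg hd
      have h4 : (n : ℝ) * κ * ((1 - τ) * geomMean (x - z)) ≤ n * K * ((1 - τ) * geomMean (x - z)) := by
        have := sub_nonneg.2 hτ1
        gcongr
      linarith

end

/-! ### Test functions touching at points of the half-open box -/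

section

variable {n : ℕ} {x y : Fin n → ℝ} {φ : (Fin n → ℝ) → ℝ}

lemma mem_Icc_of_mem_halfOpenBox (hx : x ∈ halfOpenBox y) : x ∈ Icc y 1 :=
  ⟨fun i => (hx i).1.le, fun i => (hx i).2⟩

/-- Only backward difference quotients are used, because at points with a coordinate equal to `1`
the box contains no forward directions. -/
lemma le_fderiv_of_eventually {c : ℝ} {q : Fin n → ℝ} (hφ : DifferentiableAt ℝ φ x)
    (h : ∀ᶠ t in 𝓝[>] (0 : ℝ), t * c ≤ φ x - φ (x - t • q)) : c ≤ fderiv ℝ φ x q := by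
  have h1 : HasDerivAt (fun t : ℝ => x - t • q) (-q) 0 := by
    simpa using ((hasDerivAt_id (0 : ℝ)).smul_const q).const_sub x
  have h2 : HasDerivAt (fun t : ℝ => φ (x - t • q)) (fderiv ℝ φ x (-q)) 0 := by
    have h3 : HasFDerivAt φ (fderiv ℝ φ x) (x - (0 : ℝ) • q) := by simpa using hφ.hasFDerivAt
    exact h3.comp_hasDerivAt (0 : ℝ) h1
  have h4 := (h2.neg).tendsto_slope_zero_right
  rw [map_neg, neg_neg] at h4
  refine ge_of_tendsto h4 ?_
  filter_upwards [h, self_mem_nhdsWithin] with t ht ht0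
  have ht0 : 0 < t := ht0
  simp only [zero_add, Pi.neg_apply, zero_smul, sub_zero, smul_eq_mul]
  rw [inv_mul_eq_div, le_div_iff₀ ht0]
  linarith

lemma tendsto_sub_smul_halfOpenBox (hx : x ∈ halfOpenBox y) {q : Fin n → ℝ} (hq : 0 ≤ q) :
    Tendsto (fun t : ℝ => x - t • q) (𝓝[>] 0) (𝓝[halfOpenBox y] x) := by
  have hc : Tendsto (fun t : ℝ => x - t • q) (𝓝[>] 0) (𝓝 x) := by
    have : Continuous fun t : ℝ => x - t • q := by fun_prop
    simpa using (this.tendsto 0).mono_left nhdsWithin_le_nhds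
  refine tendsto_nhdsWithin_iff.2 ⟨hc, ?_⟩
  have h1 : ∀ᶠ t in 𝓝[>] (0 : ℝ), ∀ i, y i < (x - t • q) i :=
    eventually_all.2 fun i => (tendsto_pi_nhds.1 hc i).eventually (lt_mem_nhds (hx i).1)
  filter_upwards [h1, self_mem_nhdsWithin] with t ht ht0
  refine fun i => ⟨ht i, ?_⟩
  have := mul_nonneg (le_of_lt ht0) (hq i)
  have := (hx i).2
  simp only [Pi.sub_apply, Pi.smul_apply, smul_eq_mul]
  linarith

lemma single_one_nonneg (i : Fin n) : (0 : Fin n → ℝ) ≤ Pi.single i 1 :=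
  Pi.single_nonneg.2 zero_le_one

lemma fderiv_single_nonneg (hφ : ContDiff ℝ 1 φ) (hx : x ∈ halfOpenBox y)
    {v : (Fin n → ℝ) → ℝ} (hv : MonotoneOn v (Icc y 1))
    (h : IsLocalMinOn (fun z => v z - φ z) (halfOpenBox y) x) (i : Fin n) :
    0 ≤ fderiv ℝ φ x (Pi.single i 1) := by
  refine le_fderiv_of_eventually (hφ.differentiable one_ne_zero x) ?_
  have ht := tendsto_sub_smul_halfOpenBox hx (single_one_nonneg i)
  filter_upwards [ht.eventually h, ht.eventually self_mem_nhdsWithin, self_mem_nhdsWithin]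
    with t h1 h2 h3
  have hle : x - t • Pi.single i 1 ≤ x :=
    sub_le_self _ (smul_nonneg (le_of_lt h3) (single_one_nonneg i))
  have := hv (mem_Icc_of_mem_halfOpenBox h2) (mem_Icc_of_mem_halfOpenBox hx) hle
  linarith

lemma posPartProd_nonneg : 0 ≤ posPartProd φ x :=
  Finset.prod_nonneg fun _ _ => le_max_right _ _

/-- Going backward in one coordinate does not decrease `φ`, so that partial derivative is
nonpositive and its positive part kills the product. -/
lemma posPartProd_eq_zero (hn : n ≠ 0) (hφ : ContDiff ℝ 1 φ) (hx : x ∈ halfOpenBox y)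
    (h : IsLocalMinOn φ (halfOpenBox y) x) : posPartProd φ x = 0 := by
  let i : Fin n := ⟨0, Nat.pos_of_ne_zero hn⟩
  refine Finset.prod_eq_zero (Finset.mem_univ i) (max_eq_right ?_)
  have hd := hφ.differentiable one_ne_zero x
  have : 0 ≤ fderiv ℝ (fun z => -φ z) x (Pi.single i 1) := by
    refine le_fderiv_of_eventually hd.neg ?_
    filter_upwards [(tendsto_sub_smul_halfOpenBox hx (single_one_nonneg i)).eventually h]
      with t h1
    linarith
  rw [fderiv_fun_neg] at this
  simpa using this

lemma posPartProd_const_mul {ψ : (Fin n → ℝ) → ℝ} {k : ℝ} (hk : 0 ≤ k)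
    (h : fderiv ℝ ψ x = k • fderiv ℝ φ x) : posPartProd ψ x = k ^ n * posPartProd φ x := by
  unfold posPartProd
  rw [h]
  have : ∀ i, max ((k • fderiv ℝ φ x) (Pi.single i 1)) 0 =
      k * max (fderiv ℝ φ x (Pi.single i 1)) 0 := fun i => by
    rw [mul_max_of_nonneg _ _ hk, mul_zero]; rfl
  simp_rw [this]
  rw [Finset.prod_mul_distrib]
  simp

/-! ### Comparison -/

/-- A quadratic penalty plus a linear function. -/
lemma contDiff_and_fderiv_quadratic (a b x : Fin n → ℝ) (j : ℝ) :
    ContDiff ℝ 1 (fun z : Fin n → ℝ => ∑ i, (j * (z i - a i) ^ 2 + b i * z i)) ∧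
    ∀ i, fderiv ℝ (fun z : Fin n → ℝ => ∑ i, (j * (z i - a i) ^ 2 + b i * z i)) x
      (Pi.single i 1) = 2 * j * (x i - a i) + b i := by
  refine ⟨by fun_prop, fun i => ?_⟩
  have h : ∀ k ∈ Finset.univ, HasFDerivAt (fun z : Fin n → ℝ => j * (z k - a k) ^ 2 + b k * z k)
      ((2 * j * (x k - a k) + b k) • (ContinuousLinearMap.proj (R := ℝ) (φ := fun _ : Fin n => ℝ) k))
      x := by
    intro k _
    have h1 : HasDerivAt (fun s : ℝ => j * (s - a k) ^ 2 + b k * s)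
        (2 * j * (x k - a k) + b k) (x k) := by
      have := ((((hasDerivAt_id (x k)).sub_const (a k)).pow 2).const_mul j).add
        ((hasDerivAt_id (x k)).const_mul (b k))
      refine this.congr_deriv ?_
      simp; ring
    exact h1.comp_hasFDerivAt (f := fun z : Fin n → ℝ => z k) x
      (ContinuousLinearMap.proj (R := ℝ) (φ := fun _ : Fin n => ℝ) k).hasFDerivAt
  rw [(HasFDerivAt.fun_sum h).fderiv]
  simp [Pi.single_apply]

lemma UpperSemicontinuousOn.comp_of_mapsTo {α β : Type*} [TopologicalSpace α] [TopologicalSpace β]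
    {u : α → ℝ} {s : Set α} {t : Set β} {g : β → α} (hu : UpperSemicontinuousOn u s)
    (hg : ContinuousOn g t) (hgt : MapsTo g t s) : UpperSemicontinuousOn (fun b => u (g b)) t :=
  fun b hb r hr =>
    ((hg b hb).tendsto_nhdsWithin hgt).eventually (hu (g b) (hgt hb) r hr)

lemma LowerSemicontinuousOn.neg_real {α : Type*} [TopologicalSpace α] {u : α → ℝ} {s : Set α}
    (hu : LowerSemicontinuousOn u s) : UpperSemicontinuousOn (fun a => -u a) s := by
  intro a ha r hr
  filter_upwards [hu a ha (-r) (by linarith)] with z hz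
  linarith

variable {f : (Fin n → ℝ) → ℝ}

/-- Comparison between subsolutions and nondecreasing supersolutions. -/
theorem IsViscositySubsolution.le_of_monotoneOn_supersolution (hn : n ≠ 0)
    (hf : ContinuousOn f (Icc y 1)) {u v : (Fin n → ℝ) → ℝ}
    (hu : IsViscositySubsolution y (rhs₁ f) u) (hv : IsViscositySupersolution y (rhs₁ f) v)
    (hmono : MonotoneOn v (Icc y 1)) : ∀ x ∈ Icc y 1, u x ≤ v x := by
  by_contra! hcon
  obtain ⟨a, ha, hlt⟩ := hcon
  have hK : IsCompact (Icc y 1) := isCompact_Icc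
  -- Adding `ε ∑ (zᵢ - yᵢ)` to `v` makes the supersolution strict; `ε` is small enough to keep a
  -- positive gap at `a`.
  obtain ⟨ε, hε, hεa⟩ : ∃ ε > 0, ε * ∑ i, (a i - y i) < u a - v a := by
    have h0 : 0 ≤ ∑ i, (a i - y i) := Finset.sum_nonneg fun i _ => sub_nonneg.2 (ha.1 i)
    refine ⟨(u a - v a) / (∑ i, (a i - y i) + 1), div_pos (by linarith) (by linarith), ?_⟩
    rw [div_mul_eq_mul_div, div_lt_iff₀ (by linarith)]
    nlinarith
  set θ := u a - v a - ε * ∑ i, (a i - y i) with hθ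
  have hθ0 : 0 < θ := by linarith
  -- the doubled functional without the penalty
  set Ψ : (Fin n → ℝ) × (Fin n → ℝ) → ℝ :=
    fun p => u p.1 + -v p.2 + -(ε * ∑ i, (p.2 i - y i)) with hΨ
  have hΨu : UpperSemicontinuousOn Ψ (Icc y 1 ×ˢ Icc y 1) := by
    refine UpperSemicontinuousOn.add (UpperSemicontinuousOn.add ?_ ?_) ?_
    · exact UpperSemicontinuousOn.comp_of_mapsTo hu.usc continuousOn_fst fun p hp => hp.1
    · exact UpperSemicontinuousOn.comp_of_mapsTo (u := fun z => -v z)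
        (LowerSemicontinuousOn.neg_real hv.lsc) continuousOn_snd fun p hp => hp.2
    · exact (Continuous.continuousOn (by fun_prop)).upperSemicontinuousOn
  have hKK : IsCompact (Icc y 1 ×ˢ Icc y 1) := hK.prod hK
  have hne : (Icc y 1 ×ˢ Icc y 1).Nonempty := ⟨(a, a), ha, ha⟩
  have hpen : ∀ j : ℕ, ∃ p ∈ Icc y 1 ×ˢ Icc y 1,
      IsMaxOn (fun p => Ψ p + -∑ i, j * (p.1 i - p.2 i) ^ 2) (Icc y 1 ×ˢ Icc y 1) p := fun j =>
    UpperSemicontinuousOn.exists_isMaxOn hne hKK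
      (hΨu.add (Continuous.continuousOn (by fun_prop)).upperSemicontinuousOn)
  choose p hpK hpmax using hpen
  obtain ⟨B, hB⟩ := hΨu.bddAbove_of_isCompact hKK
  have hval : ∀ j, θ + ∑ i, j * ((p j).1 i - (p j).2 i) ^ 2 ≤ Ψ (p j) := by
    intro j
    have := hpmax j (show (a, a) ∈ Icc y 1 ×ˢ Icc y 1 from ⟨ha, ha⟩)
    simp only [hΨ, mem_ofPred_eq, sub_self, ne_eq, OfNat.ofNat_ne_zero, not_false_eq_true,
      zero_pow, mul_zero, Finset.sum_const_zero, neg_zero, add_zero] at this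
    simp only [hΨ]
    linarith
  obtain ⟨⟨b, b'⟩, hbK, σ, hσ, hlim⟩ := hKK.tendsto_subseq hpK
  have hlim1 : Tendsto (fun k => (p (σ k)).1) atTop (𝓝 b) := (continuous_fst.tendsto _).comp hlim
  have hlim2 : Tendsto (fun k => (p (σ k)).2) atTop (𝓝 b') := (continuous_snd.tendsto _).comp hlim
  have hdiff : ∀ i, Tendsto (fun k => ((p (σ k)).1 i - (p (σ k)).2 i) ^ 2) atTop (𝓝 0) := by
    intro i
    refine squeeze_zero' (g := fun k : ℕ => (B - θ) / (σ k : ℝ)) (.of_forall fun k => sq_nonneg _)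
      ?_ ?_
    · filter_upwards [eventually_gt_atTop 0] with k hk
      have hσk : (0 : ℝ) < σ k := by exact_mod_cast hk.trans_le (hσ.id_le k)
      rw [le_div_iff₀ hσk]
      have h1 := hval (σ k)
      have h2 := hB ⟨p (σ k), hpK _, rfl⟩
      have h3 := Finset.single_le_sum
        (f := fun i => (σ k : ℝ) * ((p (σ k)).1 i - (p (σ k)).2 i) ^ 2)
        (fun i _ => by positivity) (Finset.mem_univ i)
      linarith
    · exact tendsto_const_nhds.div_atTop (tendsto_natCast_atTop_atTop.comp hσ.tendsto_atTop)
  have hbb : b = b' := by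
    funext i
    have h1 : Tendsto (fun k => ((p (σ k)).1 i - (p (σ k)).2 i) ^ 2) atTop
        (𝓝 ((b i - b' i) ^ 2)) :=
      ((tendsto_pi_nhds.1 hlim1 i).sub (tendsto_pi_nhds.1 hlim2 i)).pow 2
    exact sub_eq_zero.1 (pow_eq_zero_iff two_ne_zero |>.1 (tendsto_nhds_unique h1 (hdiff i)))
  subst hbb
  have hb : b ∈ Icc y 1 := hbK.1
  have hlimK : Tendsto (fun k => p (σ k)) atTop (𝓝[Icc y 1 ×ˢ Icc y 1] (b, b)) :=
    tendsto_nhdsWithin_iff.2 ⟨hlim, .of_forall fun k => hpK _⟩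
  have hpos : θ ≤ Ψ (b, b) := by
    by_contra! hlt
    obtain ⟨k, hk⟩ := (hlimK.eventually (hΨu _ hbK θ hlt)).exists
    have h1 := hval (σ k)
    have : 0 ≤ ∑ i, (σ k : ℝ) * ((p (σ k)).1 i - (p (σ k)).2 i) ^ 2 :=
      Finset.sum_nonneg fun i _ => by positivity
    linarith
  -- On the lower boundary `u ≤ 0 ≤ v`, which is incompatible with the gap `θ > 0`. Coordinates
  -- equal to `1` need no exclusion, since the equation holds there too.
  have hbD : b ∈ halfOpenBox y := by
    by_contra hbD
    have h1 := hu.boundary b ⟨hb, hbD⟩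
    have h2 := hv.boundary b ⟨hb, hbD⟩
    have h3 : 0 ≤ ε * ∑ i, (b i - y i) :=
      mul_nonneg hε.le (Finset.sum_nonneg fun i _ => sub_nonneg.2 (hb.1 i))
    simp only [hΨ] at hpos
    linarith
  have hmemD : ∀ {q : ℕ → Fin n → ℝ}, (∀ k, q k ∈ Icc y 1) → Tendsto q atTop (𝓝 b) →
      ∀ᶠ k in atTop, q k ∈ halfOpenBox y := by
    intro q hq hqb
    have : ∀ᶠ k in atTop, ∀ i, y i < q k i :=
      eventually_all.2 fun i => (tendsto_pi_nhds.1 hqb i).eventually (lt_mem_nhds (hbD i).1)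
    filter_upwards [this] with k hk i using ⟨hk i, (hq k).2 i⟩
  have hkey : ∀ᶠ k in atTop, f (p (σ k)).2 + ε ^ n ≤ f (p (σ k)).1 := by
    filter_upwards [hmemD (fun k => (hpK (σ k)).1) hlim1, hmemD (fun k => (hpK (σ k)).2) hlim2]
      with k h1 h2
    set X := (p (σ k)).1 with hX
    set Z := (p (σ k)).2 with hZ
    have hmax := hpmax (σ k)
    obtain ⟨c1, d1⟩ := contDiff_and_fderiv_quadratic Z 0 X (σ k)
    obtain ⟨c2, d2⟩ := contDiff_and_fderiv_quadratic X (fun _ => -ε) Z (-(σ k : ℝ))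
    have e1 := hu.equation X h1 _ c1 (by
      filter_upwards [self_mem_nhdsWithin] with z hz
      have := hmax (show (z, Z) ∈ Icc y 1 ×ˢ Icc y 1 from
        ⟨mem_Icc_of_mem_halfOpenBox hz, mem_Icc_of_mem_halfOpenBox h2⟩)
      simp only [hΨ, mem_ofPred_eq, ← hX, ← hZ] at this
      simp only [Pi.zero_apply, zero_mul, add_zero]
      linarith)
    have hmin : IsLocalMinOn (fun z => v z - ∑ i, (-(σ k : ℝ) * (z i - X i) ^ 2 + -ε * z i))
        (halfOpenBox y) Z := by
      filter_upwards [self_mem_nhdsWithin] with z hz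
      have := hmax (show (X, z) ∈ Icc y 1 ×ˢ Icc y 1 from
        ⟨mem_Icc_of_mem_halfOpenBox h1, mem_Icc_of_mem_halfOpenBox hz⟩)
      simp only [hΨ, mem_ofPred_eq, ← hX, ← hZ] at this
      have e : ∀ z : Fin n → ℝ, ∑ i, (-(σ k : ℝ) * (z i - X i) ^ 2 + -ε * z i) =
          -(∑ i, (σ k : ℝ) * (X i - z i) ^ 2) - ε * ∑ i, (z i - y i) - ε * ∑ i, y i := by
        intro z
        rw [Finset.mul_sum, Finset.mul_sum, ← Finset.sum_neg_distrib, ← Finset.sum_sub_distrib,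
          ← Finset.sum_sub_distrib]
        exact Finset.sum_congr rfl fun i _ => by ring
      rw [e, e]
      linarith
    have e2 := hv.equation Z h2 _ c2 hmin
    -- The two test gradients are `2σ(X - Z)` and `2σ(X - Z) - ε`. Monotonicity of `v` makes the
    -- second nonnegative, so its positive parts really increase by `ε` in every coordinate.
    have hnn := fderiv_single_nonneg c2 h2 hmono hmin
    simp only [rhs₁] at e1 e2
    refine le_trans (add_le_add_left e2 _) (le_trans ?_ e1)
    let i0 : Fin n := ⟨0, Nat.pos_of_ne_zero hn⟩
    have hεp : ε ^ n = ∏ _i : Fin n, ε := by simp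
    rw [hεp]
    unfold posPartProd
    have hle : ∀ i, max (fderiv ℝ (fun z : Fin n → ℝ =>
        ∑ i, (-(σ k : ℝ) * (z i - X i) ^ 2 + -ε * z i)) Z (Pi.single i 1)) 0 + ε ≤
        max (fderiv ℝ (fun z : Fin n → ℝ =>
        ∑ i, ((σ k : ℝ) * (z i - Z i) ^ 2 + (0 : Fin n → ℝ) i * z i)) X (Pi.single i 1)) 0 := by
      intro i
      rw [max_eq_left (hnn i), d1, d2]
      refine le_trans (le_of_eq ?_) (le_max_left _ _)
      simp only [Pi.zero_apply]; ring
    refine Finset.prod_add_prod_le (Finset.mem_univ i0) (hle i0) (fun i _ _ => ?_)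
      (fun i _ _ => ?_) (fun i _ => le_max_right _ _) (fun i _ => hε.le)
    · linarith [hle i]
    · linarith [hle i, le_max_right (fderiv ℝ (fun z : Fin n → ℝ =>
        ∑ i, (-(σ k : ℝ) * (z i - X i) ^ 2 + -ε * z i)) Z (Pi.single i 1)) 0]
  have hfl : ∀ {q : ℕ → Fin n → ℝ}, (∀ k, q k ∈ Icc y 1) → Tendsto q atTop (𝓝 b) →
      Tendsto (fun k => f (q k)) atTop (𝓝 (f b)) := fun hq hqb =>
    (hf b hb).tendsto.comp (tendsto_nhdsWithin_iff.2 ⟨hqb, .of_forall hq⟩)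
  have := le_of_tendsto_of_tendsto ((hfl (fun k => (hpK (σ k)).2) hlim2).add_const (ε ^ n))
    (hfl (fun k => (hpK (σ k)).1) hlim1) hkey
  have : 0 < ε ^ n := pow_pos hε n
  linarith

end

/-! ### The value function and existence for (P1) -/

section

variable {n : ℕ} {x y z : Fin n → ℝ} {φ : (Fin n → ℝ) → ℝ} {f : (Fin n → ℝ) → ℝ}

/-- The supremum of the lower Riemann sums over nondecreasing polygonal paths from `y` to `x`. -/
noncomputable def valueFn (f : (Fin n → ℝ) → ℝ) (y x : Fin n → ℝ) : ℝ :=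
  sSup {s | Reach f y x s}

lemma reach_zero (hn : n ≠ 0) (hyx : y ≤ x) (hf : ∀ w ∈ Icc y x, 0 ≤ f w) : Reach f y x 0 := by
  have := Reach.base.step hyx le_rfl (f := f) fun w hw => by simpa [hn] using hf w hw
  simpa using this

lemma exists_pow_bound (hn : n ≠ 0) (hf : ContinuousOn f (Icc y 1)) :
    ∃ K : ℝ, 0 ≤ K ∧ ∀ w ∈ Icc y 1, f w ≤ K ^ n := by
  obtain ⟨B, hB⟩ := isCompact_Icc.bddAbove_image hf
  refine ⟨max B 1, by positivity, fun w hw => (hB ⟨w, hw, rfl⟩).trans ?_⟩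
  exact (le_max_left B 1).trans (le_self_pow₀ (le_max_right _ _) hn)

lemma bddAbove_reach (hn : n ≠ 0) (hf : ContinuousOn f (Icc y 1)) (hx : x ≤ 1) :
    BddAbove {s | Reach f y x s} := by
  obtain ⟨K, hK, hfK⟩ := exists_pow_bound hn hf
  exact ⟨_, fun s hs => Reach.le_mul_geomMean hn hs hK fun w hw => hfK w ⟨hw.1, hw.2.trans hx⟩⟩

lemma Reach.le_valueFn (hn : n ≠ 0) (hf : ContinuousOn f (Icc y 1)) (hx : x ≤ 1) {s : ℝ}
    (h : Reach f y x s) : s ≤ valueFn f y x :=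
  le_csSup (bddAbove_reach hn hf hx) h

/-- One half of dynamic programming: any path to `z` can be prolonged by the segment from `z` to
`x`. -/
lemma valueFn_add_le (hn : n ≠ 0) (hf : ContinuousOn f (Icc y 1)) (hf0 : ∀ w ∈ Icc y 1, 0 ≤ f w)
    (hyz : y ≤ z) (hzx : z ≤ x) (hx : x ≤ 1) {κ : ℝ} (hκ : 0 ≤ κ)
    (hfκ : ∀ w ∈ Icc z x, κ ^ n ≤ f w) :
    valueFn f y z + n * κ * geomMean (x - z) ≤ valueFn f y x := by
  rw [← le_sub_iff_add_le]
  refine csSup_le ⟨0, reach_zero hn hyz fun w hw => hf0 w ⟨hw.1, hw.2.trans (hzx.trans hx)⟩⟩ ?_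
  intro s hs
  rw [le_sub_iff_add_le]
  exact (Reach.step hs hzx hκ hfκ).le_valueFn hn hf hx

lemma monotoneOn_valueFn (hn : n ≠ 0) (hf : ContinuousOn f (Icc y 1))
    (hf0 : ∀ w ∈ Icc y 1, 0 ≤ f w) : MonotoneOn (valueFn f y) (Icc y 1) := by
  intro z hz x hx hzx
  have := valueFn_add_le hn hf hf0 hz.1 hzx hx.2 le_rfl fun w hw => by
    simpa [hn] using hf0 w ⟨hz.1.trans hw.1, hw.2.trans hx.2⟩
  simpa using this

/-- The other half of dynamic programming: an `η`-optimal path is cut on `{g = 0}`. The point `z`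
does not depend on `K`, so `K` may be chosen once `z` has been located. -/
lemma valueFn_crossing (hn : n ≠ 0) (hf : ContinuousOn f (Icc y 1))
    (hf0 : ∀ w ∈ Icc y 1, 0 ≤ f w) (hx : x ∈ Icc y 1) {g : (Fin n → ℝ) → ℝ} (hg : Continuous g)
    (hgy : g y ≤ 0) (hgx : 0 ≤ g x) {η : ℝ} (hη : 0 < η) :
    ∃ z ∈ Icc y x, g z = 0 ∧ ∀ K : ℝ, 0 ≤ K → (∀ w ∈ Icc z x, f w ≤ K ^ n) →
      valueFn f y x ≤ valueFn f y z + n * K * geomMean (x - z) + η := by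
  obtain ⟨s, hs, hlt⟩ := exists_lt_of_lt_csSup
    (⟨0, reach_zero hn hx.1 fun w hw => hf0 w ⟨hw.1, hw.2.trans hx.2⟩⟩ :
      {s | Reach f y x s}.Nonempty) (show valueFn f y x - η < _ from sub_lt_self _ hη)
  obtain ⟨z, t, ht, hgz, hzx, H⟩ := Reach.exists_crossing hn hs hg hgy hgx
  refine ⟨z, ⟨ht.le, hzx⟩, hgz, fun K hK hfK => ?_⟩
  have h1 := H K hK hfK
  have h2 := ht.le_valueFn hn hf (hzx.trans hx.2)
  linarith

lemma valueFn_lowerBoundary (hn : n ≠ 0) (hf : ContinuousOn f (Icc y 1))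
    (hf0 : ∀ w ∈ Icc y 1, 0 ≤ f w) (hx : x ∈ lowerBoundary y) : valueFn f y x = 0 := by
  obtain ⟨hx, hxD⟩ := hx
  have h0 := reach_zero hn hx.1 fun w hw => hf0 w ⟨hw.1, hw.2.trans hx.2⟩
  obtain ⟨i, hi⟩ : ∃ i, x i = y i := by
    by_contra! h
    exact hxD fun i => ⟨lt_of_le_of_ne (hx.1 i) (h i).symm, hx.2 i⟩
  obtain ⟨K, hK, hfK⟩ := exists_pow_bound hn hf
  refine le_antisymm (csSup_le ⟨0, h0⟩ fun s hs => ?_) (h0.le_valueFn hn hf hx.2)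
  have := Reach.le_mul_geomMean hn hs hK fun w hw => hfK w ⟨hw.1, hw.2.trans hx.2⟩
  rwa [geomMean_eq_zero hn (i := i) (by simp [hi]), mul_zero] at this

/-- A near-optimal path to `x` is cut where it leaves `{w ≤ z}`, the zero level of `max (wᵢ - zᵢ)`.
There some coordinate equals that of `z`, so one factor of the remaining product is at most `h`, and
the others are at most `1` inside the unit cube. The result is a Hölder bound with exponent `1/n`.
-/
lemma valueFn_le_add_rpow (hn : n ≠ 0) (hf : ContinuousOn f (Icc y 1))
    (hf0 : ∀ w ∈ Icc y 1, 0 ≤ f w) (hy : 0 ≤ y) {K : ℝ} (hK : 0 ≤ K)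
    (hfK : ∀ w ∈ Icc y 1, f w ≤ K ^ n) (hz : z ∈ Icc y 1) (hx : x ∈ Icc y 1) (hzx : z ≤ x)
    {h : ℝ} (hh : ∀ i, x i - z i ≤ h) :
    valueFn f y x ≤ valueFn f y z + n * K * h ^ ((n : ℝ)⁻¹) := by
  let i0 : Fin n := ⟨0, Nat.pos_of_ne_zero hn⟩
  have hne : (Finset.univ : Finset (Fin n)).Nonempty := ⟨i0, Finset.mem_univ _⟩
  refine le_of_forall_pos_le_add fun η hη => ?_
  obtain ⟨w, hw, hgw, H⟩ := valueFn_crossing hn hf hf0 hx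
    (g := fun w => Finset.univ.sup' hne fun i => w i - z i)
    (Continuous.finset_sup'_apply hne fun i _ => by fun_prop)
    (Finset.sup'_le hne _ fun i _ => sub_nonpos.2 (hz.1 i))
    ((sub_nonneg.2 (hzx i0)).trans (Finset.le_sup' (fun i => x i - z i) (Finset.mem_univ i0))) hη
  have hwz : w ≤ z := fun i => by
    have := Finset.le_sup' (fun i => w i - z i) (Finset.mem_univ i)
    rw [hgw] at this
    linarith
  obtain ⟨i, -, hi⟩ := Finset.exists_mem_eq_sup' hne fun i => w i - z i
  rw [hgw] at hi
  have h1 := H K hK fun v hv => hfK v ⟨hw.1.trans hv.1, hv.2.trans hx.2⟩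
  have h2 := monotoneOn_valueFn hn hf hf0 ⟨hw.1, hwz.trans hz.2⟩ hz hwz
  have hd : ∀ j, 0 ≤ (x - w) j := fun j => sub_nonneg.2 (hw.2 j)
  have h3 : geomMean (x - w) ≤ h ^ ((n : ℝ)⁻¹) := by
    refine Real.rpow_le_rpow (Finset.prod_nonneg fun j _ => hd j) ?_ (by positivity)
    rw [← Finset.mul_prod_erase _ _ (Finset.mem_univ i)]
    have h4 : ∏ j ∈ Finset.univ.erase i, (x - w) j ≤ 1 := by
      refine Finset.prod_le_one (fun j _ => hd j) fun j _ => ?_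
      have a1 := hx.2 j
      have a2 := hy j
      have a3 := hw.1 j
      simp only [Pi.one_apply, Pi.zero_apply, Pi.sub_apply] at *
      linarith
    refine (mul_le_of_le_one_right (hd i) h4).trans ?_
    have := hh i
    simp only [Pi.sub_apply]
    linarith
  have h4 : n * K * geomMean (x - w) ≤ n * K * h ^ ((n : ℝ)⁻¹) := by gcongr
  linarith

lemma continuousOn_valueFn (hn : n ≠ 0) (hf : ContinuousOn f (Icc y 1))
    (hf0 : ∀ w ∈ Icc y 1, 0 ≤ f w) (hy : 0 ≤ y) : ContinuousOn (valueFn f y) (Icc y 1) := by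
  obtain ⟨K, hK, hfK⟩ := exists_pow_bound hn hf
  have key : ∀ x ∈ Icc y 1, ∀ z ∈ Icc y 1,
      valueFn f y z - valueFn f y x ≤ n * K * ‖z - x‖ ^ ((n : ℝ)⁻¹) := by
    intro x hx z hz
    -- The points `x` and `z` need not be comparable; the estimate passes through their supremum.
    have hs : x ⊔ z ∈ Icc y 1 := ⟨hx.1.trans le_sup_left, sup_le hx.2 hz.2⟩
    have h1 := monotoneOn_valueFn hn hf hf0 hz hs le_sup_right
    have h2 := valueFn_le_add_rpow hn hf hf0 hy hK hfK hx hs le_sup_left (h := ‖z - x‖)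
      fun i => by
        have := (le_abs_self _).trans (norm_le_pi_norm (z - x) i)
        simp only [Pi.sub_apply] at this
        rw [Pi.sup_apply, max_sub_sub_right _ _ _ |>.symm, sub_self]
        exact max_le (norm_nonneg _) this
    linarith
  intro x hx
  rw [ContinuousWithinAt, tendsto_iff_dist_tendsto_zero]
  have hlim : Tendsto (fun z => n * K * ‖z - x‖ ^ ((n : ℝ)⁻¹)) (𝓝[Icc y 1] x) (𝓝 0) := by
    have : Continuous fun z : Fin n → ℝ => n * K * ‖z - x‖ ^ ((n : ℝ)⁻¹) :=
      continuous_const.mul ((by fun_prop : Continuous fun z : Fin n → ℝ => ‖z - x‖).rpow_const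
        fun _ => Or.inr (by positivity))
    have h0 := (this.tendsto x).mono_left (nhdsWithin_le_nhds (s := Icc y 1))
    simpa [Real.zero_rpow (inv_ne_zero (Nat.cast_ne_zero.2 hn))] using h0
  refine squeeze_zero' (.of_forall fun _ => dist_nonneg) ?_ hlim
  filter_upwards [self_mem_nhdsWithin] with z hz
  rw [Real.dist_eq]
  refine abs_le.2 ⟨?_, key x hx z hz⟩
  have := key z hz x hx
  rw [norm_sub_rev] at this
  linarith

lemma dist_le_of_mem_Icc {w : Fin n → ℝ} (hw : w ∈ Icc z x) : dist w x ≤ dist z x := by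
  refine (dist_pi_le_iff dist_nonneg).2 fun i => le_trans ?_ (dist_le_pi_dist z x i)
  have h1 := hw.1 i
  have h2 := hw.2 i
  rw [Real.dist_eq, Real.dist_eq, abs_sub_comm, abs_sub_comm (z i), abs_of_nonneg (by linarith),
    abs_of_nonneg (by linarith)]
  linarith

lemma fderiv_apply_eq_sum (d : Fin n → ℝ) :
    fderiv ℝ φ x d = ∑ i, fderiv ℝ φ x (Pi.single i 1) * d i := by
  conv_lhs => rw [pi_eq_sum_univ' d, map_sum]
  refine Finset.sum_congr rfl fun i _ => ?_
  rw [map_smul, smul_eq_mul, mul_comm]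

lemma exists_pow_between (hn : n ≠ 0) {a b : ℝ} (ha : 0 ≤ a) (hab : a < b) :
    ∃ κ : ℝ, 0 < κ ∧ a < κ ^ n ∧ κ ^ n < b := by
  have e := Real.rpow_inv_natCast_pow (show 0 ≤ (a + b) / 2 by linarith) hn
  exact ⟨((a + b) / 2) ^ ((n : ℝ)⁻¹), Real.rpow_pos_of_pos (by linarith) _, by linarith,
    by linarith⟩

lemma isViscositySupersolution_valueFn (hn : n ≠ 0) (hf : ContinuousOn f (Icc y 1))
    (hf0 : ∀ w ∈ Icc y 1, 0 ≤ f w) (hy : 0 ≤ y) :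
    IsViscositySupersolution y (rhs₁ f) (valueFn f y) := by
  refine ⟨(continuousOn_valueFn hn hf hf0 hy).lowerSemicontinuousOn,
    fun x hx => (valueFn_lowerBoundary hn hf hf0 hx).ge, fun x hx φ hφ hmin => ?_⟩
  by_contra! hlt
  obtain ⟨κ, hκ, h1, h2⟩ := exists_pow_between hn posPartProd_nonneg hlt
  have hxI := mem_Icc_of_mem_halfOpenBox hx
  obtain ⟨δ, hδ, hball⟩ := Metric.mem_nhdsWithin_iff.1 ((hf x hxI).eventually (lt_mem_nhds h2))
  have key : ∀ ε > 0, κ ^ n ≤ ∏ i, (max (fderiv ℝ φ x (Pi.single i 1)) 0 + ε) := by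
    intro ε hε
    set m : Fin n → ℝ := fun i => max (fderiv ℝ φ x (Pi.single i 1)) 0 + ε with hm
    have hmpos : ∀ i, 0 < m i := fun i => add_pos_of_nonneg_of_pos (le_max_right _ _) hε
    -- The equality direction of AM-GM: `mᵢ qᵢ = 1` for every `i`. The shift by `ε` keeps `m`
    -- positive and is removed in the limit.
    set q : Fin n → ℝ := fun i => (m i)⁻¹ with hq
    have hqpos : ∀ i, 0 < q i := fun i => inv_pos.2 (hmpos i)
    have hq0 : (0 : Fin n → ℝ) ≤ q := fun i => (hqpos i).le
    have ht := tendsto_sub_smul_halfOpenBox hx hq0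
    have h3 : n * κ * geomMean q ≤ fderiv ℝ φ x q := by
      refine le_fderiv_of_eventually (hφ.differentiable one_ne_zero x) ?_
      filter_upwards [ht.eventually hmin, ht.eventually self_mem_nhdsWithin, self_mem_nhdsWithin,
        (ht.mono_right nhdsWithin_le_nhds).eventually (Metric.ball_mem_nhds x hδ)]
        with t a1 a2 a3 a4
      have a3 : 0 < t := a3
      have a2 := mem_Icc_of_mem_halfOpenBox a2
      have hle : x - t • q ≤ x := sub_le_self _ (smul_nonneg a3.le hq0)
      have := valueFn_add_le hn hf hf0 a2.1 hle hxI.2 hκ.le fun w hw =>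
        (hball ⟨(dist_le_of_mem_Icc hw).trans_lt a4, a2.1.trans hw.1, hw.2.trans hxI.2⟩).le
      rw [sub_sub_cancel, geomMean_smul hn a3.le fun i => (hqpos i).le] at this
      linarith
    have h4 : fderiv ℝ φ x q ≤ n := by
      rw [fderiv_apply_eq_sum]
      calc _ ≤ ∑ i : Fin n, (1 : ℝ) := by
            refine Finset.sum_le_sum fun i _ => ?_
            rw [hq, ← div_eq_mul_inv, div_le_one (hmpos i)]
            exact (le_max_left _ 0).trans (le_add_of_nonneg_right hε.le)
        _ = n := by simp
    have h5 : κ * geomMean q ≤ 1 := by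
      have hn' : (0 : ℝ) < n := by positivity
      refine le_of_mul_le_mul_left ?_ hn'
      linarith
    have h6 : κ ^ n * ∏ i, q i ≤ 1 := by
      rw [← geomMean_pow hn fun i => (hqpos i).le, ← mul_pow]
      exact pow_le_one₀ (mul_nonneg hκ.le (geomMean_nonneg fun i => (hqpos i).le)) h5
    rw [hq, Finset.prod_inv_distrib, ← div_eq_mul_inv,
      div_le_one (Finset.prod_pos fun i _ => hmpos i)] at h6
    exact h6
  have hlim : Tendsto (fun ε : ℝ => ∏ i, (max (fderiv ℝ φ x (Pi.single i 1)) 0 + ε)) (𝓝[>] 0)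
      (𝓝 (posPartProd φ x)) := by
    have : Continuous fun ε : ℝ => ∏ i, (max (fderiv ℝ φ x (Pi.single i 1)) 0 + ε) := by fun_prop
    simpa [posPartProd] using (this.tendsto 0).mono_left (nhdsWithin_le_nhds (s := Ioi 0))
  have := ge_of_tendsto hlim (by filter_upwards [self_mem_nhdsWithin] with ε hε using key ε hε)
  linarith

/-- If `∏ pᵢ > f(x)`, take `K` with `f(x) < K ^ n < ∏ pᵢ`. Near `x` a path gains at most `n K
geomMean (x - z)`, which by AM-GM is at most the fraction `K / P < 1` of the linear decrease `S` of
`φ` from `x` to `z`. Touching from above forces a gain of almost `S`, a contradiction once the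
errors are small compared with `S`. -/
lemma isViscositySubsolution_valueFn (hn : n ≠ 0) (hf : ContinuousOn f (Icc y 1))
    (hf0 : ∀ w ∈ Icc y 1, 0 ≤ f w) (hy : 0 ≤ y) :
    IsViscositySubsolution y (rhs₁ f) (valueFn f y) := by
  refine ⟨(continuousOn_valueFn hn hf hf0 hy).upperSemicontinuousOn,
    fun x hx => (valueFn_lowerBoundary hn hf hf0 hx).le, fun x hx φ hφ hmax => ?_⟩
  have hxI := mem_Icc_of_mem_halfOpenBox hx
  have hfx := hf0 x hxI
  set p : Fin n → ℝ := fun i => fderiv ℝ φ x (Pi.single i 1) with hp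
  by_cases hpos : ∀ i, 0 < p i
  swap
  · push Not at hpos
    obtain ⟨i, hi⟩ := hpos
    have : posPartProd φ x = 0 := Finset.prod_eq_zero (Finset.mem_univ i) (max_eq_right hi)
    rw [this]
    exact hfx
  by_contra! hlt
  have hprod : posPartProd φ x = ∏ i, p i :=
    Finset.prod_congr rfl fun i _ => max_eq_left (hpos i).le
  simp only [rhs₁, hprod] at hlt
  let i0 : Fin n := ⟨0, Nat.pos_of_ne_zero hn⟩
  have hne : (Finset.univ : Finset (Fin n)).Nonempty := ⟨i0, Finset.mem_univ _⟩
  obtain ⟨i1, -, hi1⟩ := Finset.exists_min_image Finset.univ p hne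
  obtain ⟨K, hK, h1, h2⟩ := exists_pow_between hn hfx hlt
  have hp0 : ∀ i, 0 ≤ p i := fun i => (hpos i).le
  set P := geomMean p with hP
  have hKP : K < P := by
    rw [← geomMean_pow hn hp0] at h2
    exact lt_of_pow_lt_pow_left₀ n (geomMean_nonneg hp0) h2
  have hP0 : 0 < P := hK.trans hKP
  -- The cutting error and the linearization error each cost `ε r`. With this `ε` their sum is half
  -- of `(1 - K / P) * p i1 * r`, while `S ≥ p i1 * r`.
  set ε := (1 - K / P) * p i1 / 4 with hε
  have hKP1 : 0 < 1 - K / P := by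
    rw [sub_pos, div_lt_one hP0]
    exact hKP
  have hε0 : 0 < ε := by have := hpos i1; positivity
  obtain ⟨δ1, hδ1, hball1⟩ :=
    Metric.mem_nhdsWithin_iff.1 ((hf x hxI).eventually (gt_mem_nhds h1))
  obtain ⟨δ2, hδ2, hball2⟩ := Metric.mem_nhdsWithin_iff.1 hmax
  have hdiff := (hφ.differentiable one_ne_zero x).hasFDerivAt.isLittleO.def hε0
  have hyx : ∀ᶠ z in 𝓝 x, ∀ i, y i < z i :=
    eventually_all.2 fun i => (continuous_apply i).continuousAt.eventually (lt_mem_nhds (hx i).1)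
  obtain ⟨δ3, hδ3, hball3⟩ := Metric.eventually_nhds_iff.1 (hdiff.and hyx)
  set r := min δ1 (min δ2 δ3) / 2 with hr
  have hr0 : 0 < r := by positivity
  have hrδ1 : r < δ1 := by
    have := min_le_left δ1 (min δ2 δ3); linarith
  have hrδ2 : r < δ2 := by
    have := (min_le_right δ1 (min δ2 δ3)).trans (min_le_left _ _); linarith
  have hrδ3 : r < δ3 := by
    have := (min_le_right δ1 (min δ2 δ3)).trans (min_le_right _ _); linarith
  have hcorner : ∀ i, y i < x i - r := by
    have hd : dist (fun i => x i - r) x < δ3 := by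
      refine lt_of_le_of_lt ((dist_pi_le_iff hr0.le).2 fun i => ?_) hrδ3
      rw [Real.dist_eq]; simp [abs_of_pos hr0]
    exact (hball3 hd).2
  -- The path is cut where it enters the cube `∏ [xᵢ - r, xᵢ]`. Some coordinate of `x - z` is then
  -- exactly `r`, which bounds `S` from below.
  obtain ⟨z, hz, hgz, H⟩ := valueFn_crossing hn hf hf0 hxI
    (g := fun w => Finset.univ.inf' hne fun i => w i - (x i - r))
    (Continuous.finset_inf'_apply hne fun i _ => by fun_prop)
    ((Finset.inf'_le (fun i => y i - (x i - r)) (Finset.mem_univ i0)).trans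
      (sub_nonpos.2 (hcorner i0).le))
    (Finset.le_inf' hne _ fun i _ => by linarith) (η := ε * r) (by positivity)
  have hzr : ∀ i, x i - r ≤ z i := fun i => by
    have := Finset.inf'_le (fun i => z i - (x i - r)) (Finset.mem_univ i)
    rw [hgz] at this
    linarith
  obtain ⟨i, -, hi⟩ := Finset.exists_mem_eq_inf' hne fun i => z i - (x i - r)
  rw [hgz] at hi
  have hzx : dist z x ≤ r := by
    refine (dist_pi_le_iff hr0.le).2 fun j => ?_
    rw [Real.dist_eq, abs_le]
    have := hz.2 j
    have := hzr j
    constructor <;> linarith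
  have hzD : z ∈ halfOpenBox y := fun j => ⟨(hcorner j).trans_le (hzr j), (hz.2 j).trans (hxI.2 j)⟩
  have e1 := H K hK.le fun w hw =>
    (hball1 ⟨(dist_le_of_mem_Icc hw).trans_lt (hzx.trans_lt hrδ1), hz.1.trans hw.1,
      hw.2.trans hxI.2⟩).le
  have e2 : valueFn f y z - φ z ≤ valueFn f y x - φ x := hball2 ⟨hzx.trans_lt hrδ2, hzD⟩
  have e3 := (hball3 (hzx.trans_lt hrδ3)).1
  rw [← dist_eq_norm z x, Real.norm_eq_abs] at e3
  have e4 : fderiv ℝ φ x (z - x) = -∑ j, p j * (x - z) j := by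
    rw [fderiv_apply_eq_sum, ← Finset.sum_neg_distrib]
    refine Finset.sum_congr rfl fun j _ => ?_
    simp only [Pi.sub_apply, hp]; ring
  rw [e4] at e3
  have hd : ∀ j, 0 ≤ (x - z) j := fun j => sub_nonneg.2 (hz.2 j)
  have e5 : n * (P * geomMean (x - z)) ≤ ∑ j, p j * (x - z) j := by
    rw [hP, ← geomMean_mul hp0 hd]
    exact natCast_mul_geomMean_le_sum hn fun j => mul_nonneg (hp0 j) (hd j)
  set S := ∑ j, p j * (x - z) j with hS
  have e6 : p i1 * r ≤ S := by
    have hir : (x - z) i = r := by simp only [Pi.sub_apply]; linarith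
    calc p i1 * r ≤ p i * (x - z) i := by
          rw [hir]
          exact mul_le_mul_of_nonneg_right (hi1 i (Finset.mem_univ i)) hr0.le
      _ ≤ S := Finset.single_le_sum (f := fun j => p j * (x - z) j)
          (fun j _ => mul_nonneg (hp0 j) (hd j)) (Finset.mem_univ i)
  have e7 : n * K * geomMean (x - z) ≤ K / P * S := by
    calc n * K * geomMean (x - z) = K / P * (n * (P * geomMean (x - z))) := by
          field_simp
      _ ≤ _ := mul_le_mul_of_nonneg_left e5 (by positivity)
  have e8 := (abs_le.1 e3).2
  have e9 : ε * dist z x ≤ ε * r := by gcongr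
  have e10 : S ≤ K / P * S + 2 * (ε * r) := by linarith
  have e11 : (1 - K / P) * S ≤ (1 - K / P) * (p i1 * r / 2) := by
    rw [hε] at e10
    linarith
  have e12 := le_of_mul_le_mul_left e11 hKP1
  have := mul_pos (hpos i1) hr0
  linarith

theorem isNondecreasingSolution_valueFn (hn : n ≠ 0) (hf : ContinuousOn f (Icc y 1))
    (hf0 : ∀ w ∈ Icc y 1, 0 ≤ f w) (hy : 0 ≤ y) :
    IsNondecreasingSolution y (rhs₁ f) (valueFn f y) :=
  ⟨monotoneOn_valueFn hn hf hf0, isViscositySubsolution_valueFn hn hf hf0 hy,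
    isViscositySupersolution_valueFn hn hf hf0 hy⟩

theorem IsNondecreasingSolution.eqOn (hn : n ≠ 0) (hf : ContinuousOn f (Icc y 1))
    {u v : (Fin n → ℝ) → ℝ} (hu : IsNondecreasingSolution y (rhs₁ f) u)
    (hv : IsNondecreasingSolution y (rhs₁ f) v) : EqOn u v (Icc y 1) := fun x hx =>
  le_antisymm (hu.sub.le_of_monotoneOn_supersolution hn hf hv.super hv.mono x hx)
    (hv.sub.le_of_monotoneOn_supersolution hn hf hu.super hu.mono x hx)

end

/-! ### The change of variables between (P1) and (P2) -/

section

variable {n : ℕ} {x y z : Fin n → ℝ} {φ : (Fin n → ℝ) → ℝ} {f : (Fin n → ℝ) → ℝ}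

/-- Test functions must be `C¹` on the whole space, whereas the `n`-th root is smooth only where its
argument is nonzero; a bump function localizes it. -/
lemma exists_contDiff_eventuallyEq {E : Type*} [NormedAddCommGroup E] [NormedSpace ℝ E]
    [HasContDiffBump E] {ψ : E → ℝ} {x : E} (h : ContDiffAt ℝ 1 ψ x) :
    ∃ ψ' : E → ℝ, ContDiff ℝ 1 ψ' ∧ ψ' =ᶠ[𝓝 x] ψ := by
  obtain ⟨ε, hε, hball⟩ := Metric.eventually_nhds_iff.1 (h.eventually (by simp))
  let b : ContDiffBump x := ⟨ε / 3, ε / 2, by positivity, by linarith⟩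
  refine ⟨fun z => b z * ψ z, contDiff_iff_contDiffAt.2 fun z => ?_, ?_⟩
  · by_cases hz : dist z x < ε
    · exact b.contDiffAt.mul (hball hz)
    · have hz' : z ∉ tsupport b := by
        rw [b.tsupport_eq, Metric.mem_closedBall, not_le]
        exact (half_lt_self hε).trans_le (not_lt.1 hz)
      refine (contDiffAt_const (c := (0 : ℝ))).congr_of_eventuallyEq ?_
      filter_upwards [notMem_tsupport_iff_eventuallyEq.1 hz'] with w hw
      simp [hw]
  · filter_upwards [b.eventuallyEq_one] with w hw
    simp [hw]

/-- The test function corresponding to `φ` under the change of variables `u = n v ^ (1 / n)`. -/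
lemma exists_transformed_test (hn : n ≠ 0) (hφ : ContDiff ℝ 1 φ) (x : Fin n → ℝ) {c : ℝ}
    (hc : 0 < c) :
    ∃ ψ : (Fin n → ℝ) → ℝ, ContDiff ℝ 1 ψ ∧
      (∀ᶠ z in 𝓝 x, 0 < c + φ z - φ x ∧ ψ z = n * (c + φ z - φ x) ^ ((n : ℝ)⁻¹)) ∧
      c ^ (n - 1) * posPartProd ψ x = posPartProd φ x := by
  have hn' : (n : ℝ) ≠ 0 := Nat.cast_ne_zero.2 hn
  have hx : c + φ x - φ x = c := by ring
  have h1 : ContDiffAt ℝ 1 (fun z => n * (c + φ z - φ x) ^ ((n : ℝ)⁻¹)) x := by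
    refine contDiffAt_const.mul (ContDiffAt.rpow_const_of_ne ?_ (by rw [hx]; exact hc.ne'))
    exact (contDiffAt_const.add hφ.contDiffAt).sub contDiffAt_const
  obtain ⟨ψ, hψ, heq⟩ := exists_contDiff_eventuallyEq h1
  refine ⟨ψ, hψ, ?_, ?_⟩
  · have hcont : Continuous fun z => c + φ z - φ x := by
      have := hφ.continuous
      fun_prop
    have := hcont.continuousAt.eventually (lt_mem_nhds (show 0 < c + φ x - φ x by rwa [hx]))
    exact this.and heq
  · set a := c ^ ((n : ℝ)⁻¹) with ha
    have ha0 : 0 < a := Real.rpow_pos_of_pos hc _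
    have han : a ^ n = c := Real.rpow_inv_natCast_pow hc.le hn
    have hd : HasFDerivAt (fun z => n * (c + φ z - φ x) ^ ((n : ℝ)⁻¹))
        ((a / c) • fderiv ℝ φ x) x := by
      have h2 : HasFDerivAt (fun z => c + φ z - φ x) (fderiv ℝ φ x) x :=
        ((hφ.differentiable one_ne_zero x).hasFDerivAt.const_add c).sub_const (φ x)
      have h3 : HasDerivAt (fun t : ℝ => n * t ^ ((n : ℝ)⁻¹)) (a / c) (c + φ x - φ x) := by
        rw [hx]
        refine ((Real.hasDerivAt_rpow_const (Or.inl hc.ne')).const_mul (n : ℝ)).congr_deriv ?_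
        rw [Real.rpow_sub_one hc.ne', ← mul_assoc, mul_inv_cancel₀ hn', one_mul]
      exact h3.comp_hasFDerivAt (f := fun z => c + φ z - φ x) x h2
    have hfd : fderiv ℝ ψ x = (a / c) • fderiv ℝ φ x := by
      rw [heq.fderiv_eq, hd.fderiv]
    rw [posPartProd_const_mul (by positivity) hfd, ← mul_assoc]
    have : c ^ (n - 1) * (a / c) ^ n = 1 := by
      rw [div_pow, han, ← mul_div_assoc, ← pow_succ, Nat.sub_add_cancel (Nat.pos_of_ne_zero hn),
        div_self (pow_ne_zero _ hc.ne')]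
    rw [this, one_mul]

/-- A test function for `n v^{1/n}` is pulled back through the `n`-th power `(b + (φ - φ(x)) / n) ^
n`, which is globally `C¹`, so no cutoff is needed. Where `v(x) = 0` the test function has a local
minimum and the inequality reduces to `f ≥ 0`. -/
lemma IsViscositySubsolution.const_mul_rpow (hn : n ≠ 0) (hf0 : ∀ w ∈ Icc y 1, 0 ≤ f w)
    {v : (Fin n → ℝ) → ℝ} (hv0 : ∀ w ∈ Icc y 1, 0 ≤ v w)
    (hv : IsViscositySubsolution y (rhs₂ f) v) :
    IsViscositySubsolution y (rhs₁ f) fun w => n * (max (v w) 0) ^ ((n : ℝ)⁻¹) := by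
  have hn' : (n : ℝ) ≠ 0 := Nat.cast_ne_zero.2 hn
  have hninv : (0 : ℝ) ≤ (n : ℝ)⁻¹ := by positivity
  refine ⟨?_, fun w hw => ?_, fun x hx φ hφ hmax => ?_⟩
  · have hg : Continuous fun t : ℝ => n * (max t 0) ^ ((n : ℝ)⁻¹) :=
      continuous_const.mul ((by fun_prop : Continuous fun t : ℝ => max t 0).rpow_const
        fun _ => Or.inr hninv)
    exact hg.comp_upperSemicontinuousOn hv.usc fun s t hst => by
      have := max_le_max_right (0 : ℝ) hst
      dsimp only
      gcongr
  · rw [max_eq_right (hv.boundary w hw), Real.zero_rpow (inv_ne_zero hn'), mul_zero]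
  · have hxI := mem_Icc_of_mem_halfOpenBox hx
    have hw0 : ∀ z, 0 ≤ n * (max (v z) 0) ^ ((n : ℝ)⁻¹) := fun z => by positivity
    rcases (hv0 x hxI).eq_or_lt with h0 | hpos
    · rw [posPartProd_eq_zero hn hφ hx]
      · exact hf0 x hxI
      · filter_upwards [hmax] with z hz
        have := hw0 z
        rw [← h0, max_self, Real.zero_rpow (inv_ne_zero hn'), mul_zero] at hz
        linarith
    · set b := (max (v x) 0) ^ ((n : ℝ)⁻¹) with hb
      have hbn : b ^ n = v x := by
        rw [hb, Real.rpow_inv_natCast_pow (le_max_right _ _) hn, max_eq_left hpos.le]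
      have hb0 : 0 ≤ b := by positivity
      have hψ : ContDiff ℝ 1 fun z => (b + (φ z - φ x) / n) ^ n := by fun_prop
      have hfd : fderiv ℝ (fun z => (b + (φ z - φ x) / n) ^ n) x = b ^ (n - 1) • fderiv ℝ φ x := by
        have h3 : HasDerivAt (fun t : ℝ => (b + (t - φ x) / n) ^ n) (b ^ (n - 1)) (φ x) := by
          have := ((((hasDerivAt_id (φ x)).sub_const (φ x)).div_const (n : ℝ)).const_add b).pow n
          refine this.congr_deriv ?_
          simp
          field_simp
        exact (h3.comp_hasFDerivAt x (hφ.differentiable one_ne_zero x).hasFDerivAt).fderiv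
      have h4 := hv.equation x hx _ hψ (by
        filter_upwards [hmax, self_mem_nhdsWithin] with z hz hzD
        have hvz := hv0 z (mem_Icc_of_mem_halfOpenBox hzD)
        have h5 : (max (v z) 0) ^ ((n : ℝ)⁻¹) ≤ b + (φ z - φ x) / n := by
          have hnp : (0 : ℝ) < n := by positivity
          rw [← sub_le_iff_le_add', le_div_iff₀ hnp]
          linarith
        have h6 := pow_le_pow_left₀ (by positivity) h5 n
        rw [Real.rpow_inv_natCast_pow (le_max_right _ _) hn, max_eq_left hvz] at h6
        simp only [sub_self, zero_div, add_zero, hbn]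
        linarith)
      rw [posPartProd_const_mul (by positivity) hfd, ← pow_mul, mul_comm (n - 1), pow_mul, hbn] at h4
      exact le_of_mul_le_mul_left h4 (pow_pos hpos _)

lemma self_mem_lowerBoundary (hn : n ≠ 0) (hy : y ≤ 1) : y ∈ lowerBoundary y :=
  ⟨⟨le_rfl, hy⟩, fun h => lt_irrefl _ (h ⟨0, Nat.pos_of_ne_zero hn⟩).1⟩

lemma IsNondecreasingSolution.nonneg (hn : n ≠ 0) {G : (Fin n → ℝ) → ℝ → ℝ}
    {u : (Fin n → ℝ) → ℝ} (hu : IsNondecreasingSolution y G u) (hx : x ∈ Icc y 1) : 0 ≤ u x :=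
  have hy := self_mem_lowerBoundary hn (hx.1.trans hx.2)
  (hu.super.boundary y hy).trans (hu.mono hy.1 hx hx.1)

lemma IsNondecreasingSolution.eq_zero {G : (Fin n → ℝ) → ℝ → ℝ}
    {u : (Fin n → ℝ) → ℝ} (hu : IsNondecreasingSolution y G u) (hx : x ∈ lowerBoundary y) :
    u x = 0 :=
  le_antisymm (hu.sub.boundary x hx) (hu.super.boundary x hx)

lemma IsNondecreasingSolution.continuousOn {G : (Fin n → ℝ) → ℝ → ℝ}
    {u : (Fin n → ℝ) → ℝ} (hu : IsNondecreasingSolution y G u) : ContinuousOn u (Icc y 1) :=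
  continuousOn_iff_lower_upperSemicontinuousOn.2 ⟨hu.super.lsc, hu.sub.usc⟩

/-- If `u(x) = 0`, the zero function touches `u` from below at `x`, and the supersolution inequality
forces `f(x) ≤ 0`. -/
lemma IsNondecreasingSolution.pos (hn : n ≠ 0) {u : (Fin n → ℝ) → ℝ}
    (hu : IsNondecreasingSolution y (rhs₁ f) u) (hx : x ∈ halfOpenBox y) (hfx : 0 < f x) :
    0 < u x := by
  refine lt_of_le_of_ne (hu.nonneg hn (mem_Icc_of_mem_halfOpenBox hx)) fun h0 => ?_
  have h1 := hu.super.equation x hx (fun _ => 0) contDiff_const (by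
    filter_upwards [self_mem_nhdsWithin] with z hz
    have := hu.nonneg hn (mem_Icc_of_mem_halfOpenBox hz)
    simpa [← h0] using this)
  rw [posPartProd_eq_zero hn contDiff_const hx (.of_forall fun _ => le_rfl)] at h1
  exact absurd h1 (not_le.2 hfx)

/-- This lets the zero extension be written `x ↦ u (x ⊔ y)`, a form in which continuity and
monotonicity are immediate. -/
lemma sup_mem_lowerBoundary (hy : y ≤ 1) (hx : x ≤ 1) (h : x ∉ halfOpenBox y) :
    x ⊔ y ∈ lowerBoundary y := by
  refine ⟨⟨le_sup_right, sup_le hx hy⟩, fun h' => h fun i => ⟨?_, hx i⟩⟩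
  have := (h' i).1
  rw [Pi.sup_apply, lt_sup_iff] at this
  exact this.resolve_right (lt_irrefl _)

/-- If `u` solves the first problem on `∏ [y i, 1]`, then `u ^ n / n ^ n`, extended by zero, solves
the second problem on the whole cube. -/
theorem IsNondecreasingSolution.pow_div_pow (hn : 2 ≤ n)
    (hf0 : ∀ w ∈ Icc (0 : Fin n → ℝ) 1, 0 ≤ f w) (hy : y ∈ Icc 0 1) {u V : (Fin n → ℝ) → ℝ}
    (hu : IsNondecreasingSolution y (rhs₁ f) u)
    (hV : ∀ x ∈ Icc (0 : Fin n → ℝ) 1, V x = u (x ⊔ y) ^ n / (n : ℝ) ^ n) :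
    IsNondecreasingSolution 0 (rhs₂ f) V := by
  have hn0 : n ≠ 0 := by omega
  have hn' : (n : ℝ) ≠ 0 := Nat.cast_ne_zero.2 hn0
  have hmaps : ∀ x ∈ Icc (0 : Fin n → ℝ) 1, x ⊔ y ∈ Icc y 1 := fun x hx =>
    ⟨le_sup_right, sup_le hx.2 hy.2⟩
  have hu0 : ∀ x ∈ Icc (0 : Fin n → ℝ) 1, 0 ≤ u (x ⊔ y) := fun x hx =>
    hu.nonneg hn0 (hmaps x hx)
  have hV0 : ∀ x ∈ Icc (0 : Fin n → ℝ) 1, 0 ≤ V x := fun x hx => by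
    rw [hV x hx]
    have := hu0 x hx
    positivity
  have hzero : ∀ x ∈ Icc (0 : Fin n → ℝ) 1, x ∉ halfOpenBox y → V x = 0 := fun x hx h => by
    rw [hV x hx, hu.eq_zero (sup_mem_lowerBoundary hy.2 hx.2 h), zero_pow hn0, zero_div]
  have hbdry : ∀ x ∈ lowerBoundary (0 : Fin n → ℝ), V x = 0 := fun x hx =>
    hzero x hx.1 fun h => hx.2 fun i => ⟨(hy.1 i).trans_lt (h i).1, (h i).2⟩
  have hsub : halfOpenBox y ⊆ halfOpenBox 0 := fun x hx i =>
    ⟨(hy.1 i).trans_lt (hx i).1, (hx i).2⟩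
  have hI : ∀ {x}, x ∈ halfOpenBox y → x ∈ Icc (0 : Fin n → ℝ) 1 := fun hx =>
    mem_Icc_of_mem_halfOpenBox (hsub hx)
  have huV : ∀ x ∈ halfOpenBox y, u x = n * V x ^ ((n : ℝ)⁻¹) := fun x hx => by
    have h1 := hu0 x (hI hx)
    have h2 : x ⊔ y = x := sup_eq_left.2 fun i => (hx i).1.le
    rw [h2] at h1
    rw [hV x (hI hx), h2, ← div_pow, Real.pow_rpow_inv_natCast (by positivity) hn0]
    field_simp
  have hcont : ContinuousOn V (Icc 0 1) := by
    refine ContinuousOn.congr (ContinuousOn.div_const (ContinuousOn.pow ?_ n) _) hV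
    exact hu.continuousOn.comp (Continuous.continuousOn <|
      continuous_pi fun i => (continuous_apply i).max continuous_const) hmaps
  refine ⟨fun x hx z hz hxz => ?_, ⟨hcont.upperSemicontinuousOn, fun x hx => (hbdry x hx).le, ?_⟩,
    ⟨hcont.lowerSemicontinuousOn, fun x hx => (hbdry x hx).ge, ?_⟩⟩
  · rw [hV x hx, hV z hz]
    have h1 := hu0 x hx
    have h2 := hu.mono (hmaps x hx) (hmaps z hz) (sup_le_sup_right hxz y)
    gcongr
  · intro x hx φ hφ hmax
    have hxI := mem_Icc_of_mem_halfOpenBox hx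
    rcases (hV0 x hxI).eq_or_lt with h0 | hpos
    · rw [posPartProd_eq_zero hn0 hφ hx]
      · exact mul_nonneg (pow_nonneg (hV0 x hxI) _) (hf0 x hxI)
      · filter_upwards [hmax, self_mem_nhdsWithin] with z hz hzD
        have := hV0 z (mem_Icc_of_mem_halfOpenBox hzD)
        rw [← h0] at hz
        linarith
    · have hxD : x ∈ halfOpenBox y := by
        by_contra h
        exact hpos.ne' (hzero x hxI h)
      obtain ⟨ψ, hψ, hev, hprod⟩ := exists_transformed_test hn0 hφ x hpos
      have hψx := hev.self_of_nhds.2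
      rw [add_sub_cancel_right, ← huV x hxD] at hψx
      have h1 := hu.sub.equation x hxD ψ hψ (by
        filter_upwards [nhdsWithin_mono x hsub hmax, self_mem_nhdsWithin,
          nhdsWithin_le_nhds hev] with z h1 hzD h3
        rw [hψx, h3.2, huV z hzD, sub_self, sub_nonpos]
        have hVz := hV0 z (hI hzD)
        have h1 : V z - φ z ≤ V x - φ x := h1
        have : V z ≤ V x + φ z - φ x := by linarith
        gcongr)
      rw [← hprod]
      exact mul_le_mul_of_nonneg_left h1 (pow_nonneg hpos.le _)
  · intro x hx φ hφ hmin
    have hxI := mem_Icc_of_mem_halfOpenBox hx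
    rcases (hV0 x hxI).eq_or_lt with h0 | hpos
    -- Here `n ≥ 2` is essential: `0 ^ (n - 1) = 0`, so the equation imposes no lower bound on the
    -- zero set.
    · rw [rhs₂, ← h0, zero_pow (by omega), zero_mul]
      exact posPartProd_nonneg
    · have hxD : x ∈ halfOpenBox y := by
        by_contra h
        exact hpos.ne' (hzero x hxI h)
      obtain ⟨ψ, hψ, hev, hprod⟩ := exists_transformed_test hn0 hφ x hpos
      have hψx := hev.self_of_nhds.2
      rw [add_sub_cancel_right, ← huV x hxD] at hψx
      have h1 := hu.super.equation x hxD ψ hψ (by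
        filter_upwards [nhdsWithin_mono x hsub hmin, self_mem_nhdsWithin,
          nhdsWithin_le_nhds hev] with z h1 hzD h3
        rw [hψx, h3.2, huV z hzD, sub_self, sub_nonneg]
        have h1 : V x - φ x ≤ V z - φ z := h1
        have h4 := h3.1
        have : V x + φ z - φ x ≤ V z := by linarith
        gcongr)
      rw [← hprod]
      exact mul_le_mul_of_nonneg_left h1 (pow_nonneg hpos.le _)

lemma IsNondecreasingSolution.extendByZero_eq (hy : y ≤ 1) {u : (Fin n → ℝ) → ℝ}
    {G : (Fin n → ℝ) → ℝ → ℝ} (hu : IsNondecreasingSolution y G u) (hx : x ≤ 1) :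
    extendByZero y u x = u (x ⊔ y) := by
  by_cases h : x ∈ Icc y 1
  · rw [extendByZero, if_pos h, sup_eq_left.2 h.1]
  · rw [extendByZero, if_neg h, hu.eq_zero (sup_mem_lowerBoundary hy hx fun h' =>
      h (mem_Icc_of_mem_halfOpenBox h'))]

/-- Take lower corners `Y t`, strictly increasing in `t`, at which `f > 0`. For `t < t'` the
solution started at `Y t` is positive at `Y t'`, while the one started at `Y t'` vanishes there.
Restriction to the cube matters, since values outside it are arbitrary. -/
theorem infinite_nondecreasingSolutions (hn : 2 ≤ n) (hf : ContinuousOn f (Icc 0 1))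
    (hf0 : ∀ w ∈ Icc (0 : Fin n → ℝ) 1, 0 ≤ f w) (hx : x ∈ Icc 0 1) (hfx : f x ≠ 0) :
    ((fun v : (Fin n → ℝ) → ℝ => (Icc (0 : Fin n → ℝ) 1).domRestrict v) ''
      {v | IsNondecreasingSolution 0 (rhs₂ f) v}).Infinite := by
  have hn0 : n ≠ 0 := by omega
  obtain ⟨δ, hδ, hball⟩ := Metric.mem_nhdsWithin_iff.1
    ((hf x hx).eventually (lt_mem_nhds (lt_of_le_of_ne (hf0 x hx) hfx.symm)))
  obtain ⟨s, hs0, hs⟩ := exists_between (lt_min hδ one_pos)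
  have hsδ := hs.trans_le (min_le_left _ _)
  have hs1 := hs.trans_le (min_le_right _ _)
  -- A convex combination of `x` and the diagonal point `(t, …, t)`: it stays in the cube, within
  -- distance `s < δ` of `x`, even when `x` is on the boundary.
  let Y : ℝ → Fin n → ℝ := fun t i => (1 - s) * x i + s * t
  have hYI : ∀ t ∈ Icc (0 : ℝ) 1, Y t ∈ Icc (0 : Fin n → ℝ) 1 := by
    refine fun t ht => ⟨fun i => ?_, fun i => ?_⟩
    · have h1 := mul_nonneg (sub_nonneg.2 hs1.le) (hx.1 i)
      have h2 := mul_nonneg hs0.le ht.1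
      simp only [Pi.zero_apply, Y] at *
      linarith
    · have h1 := mul_le_mul_of_nonneg_left (hx.2 i) (sub_nonneg.2 hs1.le)
      have h2 := mul_le_mul_of_nonneg_left ht.2 hs0.le
      simp only [Pi.one_apply, Y] at *
      linarith
  have hYf : ∀ t ∈ Icc (0 : ℝ) 1, 0 < f (Y t) := by
    refine fun t ht => hball ⟨lt_of_le_of_lt ((dist_pi_le_iff hs0.le).2 fun i => ?_) hsδ, hYI t ht⟩
    have h1 : Y t i - x i = s * (t - x i) := by simp only [Y]; ring
    rw [Real.dist_eq, h1, abs_mul, abs_of_pos hs0]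
    refine mul_le_of_le_one_right hs0.le (abs_le.2 ?_)
    have h2 := hx.1 i
    have h3 := hx.2 i
    simp only [Pi.zero_apply, Pi.one_apply] at h2 h3
    constructor <;> linarith [ht.1, ht.2]
  have hYlt : ∀ {t t'}, t < t' → ∀ i, Y t i < Y t' i := fun h i => by
    have := mul_lt_mul_of_pos_left h hs0
    simp only [Y]
    linarith
  have hsol : ∀ t ∈ Icc (0 : ℝ) 1, IsNondecreasingSolution (Y t) (rhs₁ f) (valueFn f (Y t)) :=
    fun t ht =>
      have hsub : Icc (Y t) 1 ⊆ Icc 0 1 := Icc_subset_Icc_left (hYI t ht).1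
      isNondecreasingSolution_valueFn hn0 (hf.mono hsub) (fun w hw => hf0 w (hsub hw)) (hYI t ht).1
  let V : ℝ → (Fin n → ℝ) → ℝ := fun t x => valueFn f (Y t) (x ⊔ Y t) ^ n / (n : ℝ) ^ n
  have hne : ∀ t ∈ Icc (0 : ℝ) 1, ∀ t' ∈ Icc (0 : ℝ) 1, t < t' →
      V t (Y t') ≠ V t' (Y t') := by
    intro t ht t' ht' h
    have h1 : 0 < valueFn f (Y t) (Y t') := (hsol t ht).pos hn0
      (fun i => ⟨hYlt h i, (hYI t' ht').2 i⟩) (hYf t' ht')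
    have h2 : valueFn f (Y t') (Y t') = 0 :=
      (hsol t' ht').eq_zero (self_mem_lowerBoundary hn0 (hYI t' ht').2)
    have h3 : Y t' ⊔ Y t = Y t' := sup_eq_left.2 fun i => (hYlt h i).le
    simp only [V, h3, sup_idem, h2, zero_pow hn0, zero_div]
    positivity
  refine infinite_of_injOn_mapsTo (f := fun t => (Icc (0 : Fin n → ℝ) 1).domRestrict (V t))
    (s := Icc (0 : ℝ) 1) ?_ (fun t ht => ⟨V t, ?_, rfl⟩) (Icc_infinite zero_lt_one)
  · intro t ht t' ht' heq
    rcases lt_trichotomy t t' with h | h | h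
    · exact absurd (congrFun heq ⟨Y t', hYI t' ht'⟩) (hne t ht t' ht' h)
    · exact h
    · exact absurd (congrFun heq ⟨Y t, hYI t ht⟩).symm (hne t' ht' t ht h)
  · exact (hsol t ht).pow_div_pow hn hf0 (hYI t ht) fun x _ => rfl

end

end NondomHJ

theorem mainTheorem12 (n : ℕ) (hn : 1 ≤ n) (f : (Fin n → ℝ) → ℝ)
    (hf : ContinuousOn f (Set.Icc 0 1)) (hf0 : ∀ x ∈ Set.Icc (0 : Fin n → ℝ) 1, 0 ≤ f x) :
    -- existence and uniqueness of the nondecreasing solution on every box with upper corner `1`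
    (∀ y ∈ Set.Icc (0 : Fin n → ℝ) 1, ∃ u : (Fin n → ℝ) → ℝ,
      NondomHJ.IsNondecreasingSolution y (NondomHJ.rhs₁ f) u ∧
      ∀ u' : (Fin n → ℝ) → ℝ, NondomHJ.IsNondecreasingSolution y (NondomHJ.rhs₁ f) u' →
        Set.EqOn u' u (Set.Icc y 1)) ∧
    -- the maximal solution of the transformed problem
    (∀ u : (Fin n → ℝ) → ℝ, NondomHJ.IsNondecreasingSolution 0 (NondomHJ.rhs₁ f) u →
      (∀ v : (Fin n → ℝ) → ℝ, (∀ x ∈ Set.Icc (0 : Fin n → ℝ) 1, 0 ≤ v x) →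
        NondomHJ.IsViscositySubsolution 0 (NondomHJ.rhs₂ f) v →
        ∀ x ∈ Set.Icc (0 : Fin n → ℝ) 1, v x ≤ u x ^ n / (n : ℝ) ^ n) ∧
      NondomHJ.IsNondecreasingSolution 0 (NondomHJ.rhs₂ f)
        (fun x => u x ^ n / (n : ℝ) ^ n)) ∧
    -- the shifted problems give further nondecreasing solutions
    (2 ≤ n → ∀ y ∈ Set.Icc (0 : Fin n → ℝ) 1, ∀ u : (Fin n → ℝ) → ℝ,
      NondomHJ.IsNondecreasingSolution y (NondomHJ.rhs₁ f) u →
      NondomHJ.IsNondecreasingSolution 0 (NondomHJ.rhs₂ f)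
        (fun x => NondomHJ.extendByZero y u x ^ n / (n : ℝ) ^ n)) ∧
    -- infinitely many of them, counted as functions on the cube
    (2 ≤ n → (∃ x ∈ Set.Icc (0 : Fin n → ℝ) 1, f x ≠ 0) →
      ((fun v : (Fin n → ℝ) → ℝ => (Set.Icc (0 : Fin n → ℝ) 1).domRestrict v) ''
        {v | NondomHJ.IsNondecreasingSolution 0 (NondomHJ.rhs₂ f) v}).Infinite) := by
  have hn0 : n ≠ 0 := Nat.one_le_iff_ne_zero.1 hn
  have hsub : ∀ {y : Fin n → ℝ}, y ∈ Icc (0 : Fin n → ℝ) 1 → Icc y 1 ⊆ Icc 0 1 := fun hy =>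
    Icc_subset_Icc_left hy.1
  have h3 : 2 ≤ n → ∀ y ∈ Icc (0 : Fin n → ℝ) 1, ∀ u : (Fin n → ℝ) → ℝ,
      NondomHJ.IsNondecreasingSolution y (NondomHJ.rhs₁ f) u →
      NondomHJ.IsNondecreasingSolution 0 (NondomHJ.rhs₂ f)
        (fun x => NondomHJ.extendByZero y u x ^ n / (n : ℝ) ^ n) := fun h2 y hy u hu =>
    hu.pow_div_pow h2 hf0 hy fun x hx => by rw [hu.extendByZero_eq hy.2 hx.2]
  refine ⟨fun y hy => ?_, fun u hu => ⟨fun v hv0 hv x hx => ?_, ?_⟩, h3, fun h2 ⟨x, hx, hfx⟩ =>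
    NondomHJ.infinite_nondecreasingSolutions h2 hf hf0 hx hfx⟩
  · have hfy := hf.mono (hsub hy)
    have hu := NondomHJ.isNondecreasingSolution_valueFn hn0 hfy (fun w hw => hf0 w (hsub hy hw)) hy.1
    exact ⟨_, hu, fun u' hu' => hu'.eqOn hn0 hfy hu⟩
  · have h1 := (hv.const_mul_rpow hn0 hf0 hv0).le_of_monotoneOn_supersolution hn0 hf hu.super
      hu.mono x hx
    have hn' : (0 : ℝ) < n := by positivity
    rw [← le_div_iff₀' hn'] at h1
    have h4 := pow_le_pow_left₀ (by positivity) h1 n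
    rwa [Real.rpow_inv_natCast_pow (le_max_right _ _) hn0, max_eq_left (hv0 x hx), div_pow] at h4
  -- For `n = 1` the two equations coincide and the transformation is the identity; the argument
  -- through the zero set requires `n ≥ 2`.
  · rcases hn.eq_or_lt with rfl | h2
    · have : NondomHJ.rhs₂ f = NondomHJ.rhs₁ f := by
        funext x z
        simp [NondomHJ.rhs₁, NondomHJ.rhs₂]
      rw [this]
      simpa using hu
    · refine hu.pow_div_pow h2 hf0 ⟨le_rfl, zero_le_one⟩ fun x hx => ?_
      rw [sup_eq_left.2 hx.1]
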